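/- For a commutative ring $R$, call an $R$-module $M$ \emph{f-projective} if it is flat and $\{R\}$-Mittag-Leffler, the latter meaning that for every set $I$ the canonical map $M\otimes_R R^I\to \prod_{i\in I} (M\otimes_R R)$, $m\otimes (r_i)_{i\in I}\mapsto (m\otimes r_i)_{i\in I}$, is injective. A quasi-coherent sheaf $\mathcal M$ on a scheme $X$ is called \emph{locally f-projective} if for every open affine subset $u\subseteq X$ the $\mathcal O_X(u)$-module of sections $\mathcal M(u)$ is f-projective. \textbf{Theorem.} The notion of a locally f-projective quasi-coherent sheaf is Zariski local on the class of all schemes. That is, let $X$ be any scheme, let $X=\bigcup_{v\in V} v$ be any open affine covering of $X$, and let $\mathcal M$ be any quasi-coherent sheaf on $X$. If $\mathcal M(v)$ is an f-projective $\mathcal O_X(v)$-module for every $v\in V$, then $\mathcal M$ is locally f-projective. -/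

import Mathlib

universe u

open CategoryTheory AlgebraicGeometry TensorProduct

/-- A property of modules over commutative rings, given for every ring and every module over it. -/
abbrev ModuleProperty : Type (u + 1) :=
  ∀ (R : Type u) [CommRing R] (M : Type u) [AddCommGroup M] [Module R M], Prop

/-- An `R`-module `M` is Mittag-Leffler relative to a class `𝒬` of `R`-modules if for every family
`(Q i)` of members of `𝒬` the canonical map `M ⊗ ∏ Q i → ∏ (M ⊗ Q i)`,
`m ⊗ (q i) ↦ (m ⊗ q i)`, is injective. -/
def IsMittagLefflerRelativeTo {R : Type u} [CommRing R] (𝒬 : Set (ModuleCat.{u} R))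
    (M : Type u) [AddCommGroup M] [Module R M] : Prop :=
  ∀ (I : Type u) (Q : I → ModuleCat.{u} R), (∀ i, Q i ∈ 𝒬) →
    Function.Injective (TensorProduct.piRightHom R R M (fun i => (Q i : Type u)))

/-- An `R`-module is f-projective if it is flat and Mittag-Leffler relative to the class `{R}`. -/
def IsFProjective : ModuleProperty.{u} := fun R _ M _ _ =>
  Module.Flat R M ∧ IsMittagLefflerRelativeTo {ModuleCat.of R R} M

/-- A sheaf of modules on a scheme `X` is locally `P`-quasi-coherent if it is quasi-coherent and its
module of sections over each open affine `u` of `X` has the property `P` as a module over the ring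
of sections of the structure sheaf over `u`. -/
def IsLocallyQuasicoherentWith (P : ModuleProperty.{u}) {X : Scheme.{u}} (M : X.Modules) : Prop :=
  M.IsQuasicoherent ∧ ∀ u : X.Opens, IsAffineOpen u → P Γ(X, u) Γ(M, u)

/-- The notion of a locally `P`-quasi-coherent sheaf is Zariski local on a class `C` of schemes if
for each `X` in `C`, each covering `V` of `X` by open affines and each quasi-coherent sheaf `M`
on `X`: if the sections of `M` over each member of `V` have property `P`, then `M` is locally
`P`-quasi-coherent. -/
def IsZariskiLocalOn (P : ModuleProperty.{u}) (C : Set Scheme.{u}) : Prop :=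
  ∀ X ∈ C, ∀ V : Set X.Opens, (∀ v ∈ V, IsAffineOpen v) → sSup V = ⊤ →
    ∀ M : X.Modules, M.IsQuasicoherent →
      (∀ v ∈ V, P Γ(X, v) Γ(M, v)) → IsLocallyQuasicoherentWith P M

/-! By the affine communication lemma (`of_affine_open_cover`), it suffices that f-projectivity
passes to localizations and descends along finitely many localizations at elements generating the
unit ideal. Ascent: in an f-projective module every finite tuple factors through some `R^k` in which
all its relations already hold (`IsFProjective.exists_factorization`); relations over the
localization reduce to these by clearing denominators. Descent: flatness is local, and `M ⊗ R^I`
embeds in the finite product of the `N f ⊗ (S f)^I`, where the canonical maps are injective. -/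

theorem isMittagLefflerRelativeTo_singleton_iff {R : Type u} [CommRing R]
    (M : Type u) [AddCommGroup M] [Module R M] :
    IsMittagLefflerRelativeTo {ModuleCat.of R R} M ↔
      ∀ I : Type u, Function.Injective (piRightHom R R M (fun _ : I => R)) := by
  refine ⟨fun h I => h I (fun _ => ModuleCat.of R R) (fun _ => rfl), fun h I Q hQ => ?_⟩
  obtain rfl : Q = fun _ => ModuleCat.of R R := funext hQ
  exact h I

theorem IsFProjective.exists_factorization {R : Type u} [CommRing R]
    {M : Type u} [AddCommGroup M] [Module R M] (hM : IsFProjective R M) {n : ℕ} (m : Fin n → M) :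
    ∃ (k : ℕ) (a : Fin n → Fin k → R) (y : Fin k → M), (∀ i, m i = ∑ j, a i j • y j) ∧
      ∀ r : Fin n → R, ∑ i, r i • m i = 0 → ∀ j, ∑ i, a i j * r i = 0 := by
  have := hM.1
  -- Indexing by all relations at once encodes them in the single equation `∑ m i ⊗ c i = 0`, to
  -- which the equational criterion for vanishing applies.
  let I := {r : Fin n → R // ∑ i, r i • m i = 0}
  have hI := (isMittagLefflerRelativeTo_singleton_iff M).mp hM.2 I
  let c : Fin n → I → R := fun i r => r.1 i
  have h0 : ∑ i, m i ⊗ₜ[R] c i = 0 := by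
    apply hI
    rw [map_zero, map_sum]
    funext r
    apply (TensorProduct.rid R M).injective
    simpa [c] using r.2
  have h1 : ∑ i, c i ⊗ₜ[R] m i = 0 := by
    simpa using congrArg (TensorProduct.comm R M (I → R)) h0
  obtain ⟨k, a, y, h2, h3⟩ := vanishesTrivially_of_sum_tmul_eq_zero_of_rTensor_injective R
    (Module.Flat.rTensor_preserves_injective_linearMap _ (Submodule.injective_subtype _)) h1
  refine ⟨k, a, y, h2, fun r hr j => ?_⟩
  simpa [c] using congrFun (h3 j) ⟨r, hr⟩

section Localization

variable {R S : Type u} [CommRing R] [CommRing S] [Algebra R S]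
  {M N : Type u} [AddCommGroup M] [Module R M] [AddCommGroup N] [Module R N] [Module S N]
  [IsScalarTower R S N]

/-- Denominators can be moved across the tensor sign into `P`. -/
theorem exists_sum_tmul_of_isLocalizedModule (p : Submonoid R) [IsLocalization p S]
    (g : M →ₗ[R] N) [IsLocalizedModule p g] {P : Type u} [AddCommGroup P] [Module S P]
    (x : N ⊗[S] P) :
    ∃ (n : ℕ) (m : Fin n → M) (s : Fin n → P), x = ∑ k, g (m k) ⊗ₜ[S] s k := by
  induction x with
  | zero => exact ⟨0, Fin.elim0, Fin.elim0, by simp⟩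
  | tmul x s =>
    obtain ⟨⟨m, t⟩, rfl⟩ := IsLocalizedModule.mk'_surjective p g x
    refine ⟨1, fun _ => m, fun _ => IsLocalization.mk' S 1 t • s, ?_⟩
    have : g m = algebraMap R S t • IsLocalizedModule.mk' g m t := by
      rw [algebraMap_smul, ← Submonoid.smul_def, IsLocalizedModule.mk'_cancel']
    simp only [Finset.univ_unique, Finset.sum_const, Finset.card_singleton, one_smul,
      Function.uncurry_apply_pair]
    rw [← smul_tmul, this, smul_smul, IsLocalization.mk'_spec, map_one, one_smul]
  | add x y hx hy =>
    obtain ⟨n, m, s, rfl⟩ := hx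
    obtain ⟨n', m', s', rfl⟩ := hy
    exact ⟨n + n', Fin.append m m', Fin.append s s', by simp [Fin.sum_univ_add]⟩

theorem IsFProjective.of_isLocalizedModule (p : Submonoid R) [IsLocalization p S]
    (g : M →ₗ[R] N) [IsLocalizedModule p g] (hM : IsFProjective R M) : IsFProjective S N := by
  have := hM.1
  refine ⟨.of_isLocalizedModule S p g, (isMittagLefflerRelativeTo_singleton_iff N).mpr fun I => ?_⟩
  rw [injective_iff_map_eq_zero]
  intro x hx
  obtain ⟨n, m, s, rfl⟩ := exists_sum_tmul_of_isLocalizedModule p g x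
  obtain ⟨k, a, y, hm, ha⟩ := hM.exists_factorization m
  have key (j : Fin k) : ∑ i, a i j • s i = 0 := by
    funext i
    have h0 : ∑ l, s l i • g (m l) = 0 := by
      rw [map_sum] at hx
      simpa using congrArg (TensorProduct.rid S N) (congrFun hx i)
    -- `b` clears the denominators of the coefficients; `c` below kills the resulting element of
    -- `ker g`, giving a relation over `R`.
    obtain ⟨b, hb⟩ := IsLocalization.exist_integer_multiples_of_finite p (fun l => s l i)
    choose r hr using hb
    have h1 : g (∑ l, r l • m l) = 0 := by
      have : ∑ l, (b : R) • (s l i • g (m l)) = 0 := by rw [← Finset.smul_sum, h0, smul_zero]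
      rw [map_sum, ← this]
      refine Finset.sum_congr rfl fun l _ => ?_
      rw [map_smul, ← smul_assoc, ← hr, algebraMap_smul]
    obtain ⟨c, hc⟩ := (IsLocalizedModule.eq_zero_iff p g).mp h1
    have h2 := ha (fun l => c * r l) (by
      simpa [Finset.smul_sum, mul_smul, Submonoid.smul_def] using hc) j
    have h3 : algebraMap R S (c * b) * ∑ l, a l j • s l i = 0 := by
      have := congrArg (algebraMap R S) h2
      rw [map_sum, map_zero] at this
      rw [← this, Finset.mul_sum]
      refine Finset.sum_congr rfl fun l _ => ?_
      simp only [map_mul, hr, Algebra.smul_def]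
      ring
    simpa using (IsLocalization.map_units S (c * b)).mul_right_eq_zero.mp (by simpa using h3)
  calc ∑ i, g (m i) ⊗ₜ[S] s i
      = ∑ i, ∑ j, g (y j) ⊗ₜ[S] (a i j • s i) := by
        refine Finset.sum_congr rfl fun i _ => ?_
        conv_lhs => rw [hm i]
        simp only [map_sum, map_smul, sum_tmul]
        refine Finset.sum_congr rfl fun j _ => ?_
        rw [← algebraMap_smul S, smul_tmul, algebraMap_smul]
    _ = 0 := by
        rw [Finset.sum_comm]
        refine Finset.sum_eq_zero fun j _ => ?_
        rw [← tmul_sum, key, tmul_zero]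

/-- Since `N` is the base change of `M`, cancelling base change identifies the two tensor products.
-/
theorem exists_injective_tmul_of_isLocalizedModule (p : Submonoid R) [IsLocalization p S]
    (g : M →ₗ[R] N) [IsLocalizedModule p g] (P : Type u) [AddCommGroup P] [Module R P] [Module S P]
    [IsScalarTower R S P] :
    ∃ e : M ⊗[R] P →+ N ⊗[S] P, Function.Injective e ∧ ∀ m t, e (m ⊗ₜ t) = g m ⊗ₜ t := by
  have hb := IsLocalizedModule.isBaseChange p S g
  let e := (TensorProduct.comm R M P).toAddEquiv.trans <|
    (AlgebraTensorModule.cancelBaseChange R S S P M).symm.toAddEquiv.trans <|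
    (TensorProduct.congr (.refl S P) hb.equiv).toAddEquiv.trans <|
    (TensorProduct.comm S P N).toAddEquiv
  refine ⟨e, e.injective, fun m t => ?_⟩
  simp [e, IsBaseChange.equiv_tmul]

end Localization

section Descent

variable {R : Type u} [CommRing R] (s : Finset R) (hs : Ideal.span (s : Set R) = ⊤)
  (S : s → Type u) [∀ f, CommRing (S f)] [∀ f, Algebra R (S f)]
  [∀ f : s, IsLocalization.Away f.1 (S f)]

include hs in
theorem injective_pi_algebraMap_of_span_eq_top (I : Type u) :
    Function.Injective (LinearMap.pi fun f : s =>
      LinearMap.compLeft (Algebra.linearMap R (S f)) I) := by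
  rw [injective_iff_map_eq_zero]
  intro c hc
  funext i
  refine Module.eq_zero_of_isLocalized_span (s : Set R) hs (fun f => S ⟨f.1, f.2⟩)
    (fun f => Algebra.linearMap R (S ⟨f.1, f.2⟩)) (c i) fun f => ?_
  simpa using congrFun (congrFun hc ⟨f.1, f.2⟩) i

variable {M : Type u} [AddCommGroup M] [Module R M]
  (N : s → Type u) [∀ f, AddCommGroup (N f)] [∀ f, Module R (N f)] [∀ f, Module (S f) (N f)]
  [∀ f, IsScalarTower R (S f) (N f)] (g : ∀ f, M →ₗ[R] N f)
  [∀ f : s, IsLocalizedModule.Away f.1 (g f)]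

include hs g in
theorem IsFProjective.of_isLocalized_span (h : ∀ f, IsFProjective (S f) (N f)) :
    IsFProjective R M := by
  have hflat : Module.Flat R M := by
    refine Module.flat_of_isLocalized_span (R := R) R M (s : Set R) hs (fun f => N ⟨f.1, f.2⟩)
      (fun f => g ⟨f.1, f.2⟩) fun f => ?_
    exact (Module.flat_iff_of_isLocalization (S ⟨f.1, f.2⟩) (.powers f.1) _).mp (h ⟨f.1, f.2⟩).1
  refine ⟨hflat, (isMittagLefflerRelativeTo_singleton_iff M).mpr fun I => ?_⟩
  rw [injective_iff_map_eq_zero]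
  intro x hx
  apply Module.Flat.lTensor_preserves_injective_linearMap (M := M) _
    (injective_pi_algebraMap_of_span_eq_top s hs S I)
  rw [map_zero]
  classical
  -- Finiteness of `s` lets the tensor product commute with the product over `s`.
  apply (TensorProduct.piRight R R M (fun f : s => I → S f)).injective
  rw [map_zero]
  funext f
  obtain ⟨e, he, he'⟩ := exists_injective_tmul_of_isLocalizedModule (S := S f) (.powers f.1) (g f) (I → S f)
  apply he
  rw [Pi.zero_apply, map_zero]
  apply (isMittagLefflerRelativeTo_singleton_iff (N f)).mp (h f).2 I
  rw [map_zero]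
  funext i
  obtain ⟨e₁, -, he₁⟩ := exists_injective_tmul_of_isLocalizedModule (S := S f) (.powers f.1) (g f) (S f)
  -- Naturality: each local coordinate is determined by the global one, which vanishes by `hx`.
  have : piRightHom (S f) (S f) (N f) (fun _ : I => S f) (e (TensorProduct.piRight R R M
      (fun f : s => I → S f) (LinearMap.lTensor M (LinearMap.pi fun f : s =>
      LinearMap.compLeft (Algebra.linearMap R (S f)) I) x) f)) i =
      e₁ (LinearMap.lTensor M (Algebra.linearMap R (S f))
        (piRightHom R R M (fun _ : I => R) x i)) := by
    clear hx
    induction x with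
    | zero => simp
    | tmul m c =>
      simp [he', he₁]
    | add x y hx hy => simp only [map_add, Pi.add_apply, hx, hy]
  rw [this, hx]
  simp

end Descent
namespace AlgebraicGeometry.IsAffineOpen

variable {X : Scheme.{u}} {U : X.Opens} (hU : IsAffineOpen U)

include hU in
theorem image_fromSpec_le (W : (Spec Γ(X, U)).Opens) : hU.fromSpec ''ᵁ W ≤ U :=
  (Scheme.Hom.image_mono _ le_top).trans (by simp)

theorem fromSpec_appIso_inv (W : (Spec Γ(X, U)).Opens) (r : Γ(X, U)) :
    (hU.fromSpec.appIso W).inv ((Spec Γ(X, U)).presheaf.map W.leTop.op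
      ((Scheme.ΓSpecIso Γ(X, U)).inv r)) =
      X.presheaf.map (homOfLE (hU.image_fromSpec_le W)).op r := by
  have hW : W ≤ hU.fromSpec ⁻¹ᵁ U := by simp
  have h : (Scheme.ΓSpecIso Γ(X, U)).inv ≫ (Spec Γ(X, U)).presheaf.map W.leTop.op =
      hU.fromSpec.appLE U W hW := by
    rw [Scheme.Hom.appLE, fromSpec_app_self, Category.assoc, ← Functor.map_comp]
    rfl
  have h' := Scheme.Hom.appLE_appIso_inv hU.fromSpec hW
  rw [← h] at h'
  exact congr($h' r)

theorem smul_restrict_fromSpec (M : X.Modules) (W : (Spec Γ(X, U)).Opens) (r : Γ(X, U))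
    (x : Γ(M.restrict hU.fromSpec, W)) :
    (M.restrictAppIso hU.fromSpec W).hom (r • x) =
      X.presheaf.map (homOfLE (hU.image_fromSpec_le W)).op r •
        (M.restrictAppIso hU.fromSpec W).hom x := by
  rw [← hU.fromSpec_appIso_inv]
  rfl

include hU in
-- Quasi-coherence on `Spec Γ(X, U)` makes restriction to a basic open a localization. Keeping `T`
-- and `V` as variables avoids transport along `U = hU.fromSpec ''ᵁ ⊤`.
theorem exists_pow_smul_map (M : X.Modules) [M.IsQuasicoherent] (f : Γ(X, U)) {T V : X.Opens}
    (hT : T = hU.fromSpec ''ᵁ ⊤) (hV : V = hU.fromSpec ''ᵁ PrimeSpectrum.basicOpen f)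
    (hTU : T ≤ U) (hVU : V ≤ U) (hVT : V ≤ T) :
    (∀ x : Γ(M, V), ∃ (n : ℕ) (y : Γ(M, T)),
      X.presheaf.map (homOfLE hVU).op (f ^ n) • x = M.presheaf.map (homOfLE hVT).op y) ∧
    ∀ y : Γ(M, T), M.presheaf.map (homOfLE hVT).op y = 0 →
      ∃ n : ℕ, X.presheaf.map (homOfLE hTU).op (f ^ n) • y = 0 := by
  subst hT hV
  have h := (isIso_fromTildeΓ_iff_isLocalizing (M.restrict hU.fromSpec)).mp inferInstance f
  constructor
  · intro x
    obtain ⟨⟨y, ⟨_, n, rfl⟩⟩, hy⟩ := h.surj x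
    refine ⟨n, y, ?_⟩
    exact (hU.smul_restrict_fromSpec M _ (f ^ n) x).symm.trans hy
  · intro y hy
    obtain ⟨⟨_, n, rfl⟩, hn⟩ := h.exists_of_eq (x₁ := y) (x₂ := 0) (hy.trans (map_zero _).symm)
    refine ⟨n, ?_⟩
    exact (hU.smul_restrict_fromSpec M _ (f ^ n) y).symm.trans (hn.trans (smul_zero _))

end AlgebraicGeometry.IsAffineOpen

namespace AlgebraicGeometry.Scheme.Modules

variable {X : Scheme.{u}} (M : X.Modules) {U : X.Opens} (f : Γ(X, U))

/-- Sections over `D(f)` form a module over the sections of the structure sheaf over `U`. -/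
@[reducible] noncomputable def moduleBasicOpen : Module Γ(X, U) Γ(M, X.basicOpen f) :=
  Module.compHom _ (algebraMap Γ(X, U) Γ(X, X.basicOpen f))

attribute [local instance] moduleBasicOpen

instance isScalarTower_basicOpen :
    IsScalarTower Γ(X, U) Γ(X, X.basicOpen f) Γ(M, X.basicOpen f) :=
  .of_algebraMap_smul fun _ _ => rfl

/-- The restriction of sections over `U` to `D(f)`, as a linear map. -/
noncomputable def restrictBasicOpen : Γ(M, U) →ₗ[Γ(X, U)] Γ(M, X.basicOpen f) where
  toFun := M.presheaf.map (homOfLE (X.basicOpen_le f)).op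
  map_add' := map_add _
  map_smul' r x := M.map_smul (homOfLE (X.basicOpen_le f)) r x

theorem isLocalizedModule_restrictBasicOpen [M.IsQuasicoherent] (hU : IsAffineOpen U) :
    IsLocalizedModule.Away f (M.restrictBasicOpen f) := by
  obtain ⟨h₁, h₂⟩ := hU.exists_pow_smul_map M f (T := U) (by simp)
    (hU.fromSpec_image_basicOpen f).symm le_rfl (X.basicOpen_le f) (X.basicOpen_le f)
  have := hU.isLocalization_basicOpen f
  refine IsLocalizedModule.Away.mk_of_addCommGroup ?_ h₁ fun y hy => ?_
  · have := ((IsLocalization.Away.algebraMap_isUnit (S := Γ(X, X.basicOpen f)) f).map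
      (algebraMap _ (Module.End Γ(X, X.basicOpen f) Γ(M, X.basicOpen f))))
    rw [Module.End.isUnit_iff] at this ⊢
    exact this
  · obtain ⟨n, hn⟩ := h₂ y hy
    refine ⟨n, ?_⟩
    simpa using hn

end AlgebraicGeometry.Scheme.Modules

attribute [local instance] Scheme.Modules.moduleBasicOpen in
theorem theorem4p1 : IsZariskiLocalOn IsFProjective.{u} (Set.univ : Set Scheme.{u}) := by
  intro X _ V hV hcov M hM h
  refine ⟨hM, fun u hu => ?_⟩
  refine of_affine_open_cover (P := fun u : X.affineOpens => IsFProjective Γ(X, u) Γ(M, u))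
    (fun v : V => ⟨v.1, hV v.1 v.2⟩) ?_ ⟨u, hu⟩ ?_ ?_ fun v => h v.1 v.2
  · rw [← hcov, sSup_eq_iSup']
  · intro u f hf
    have := u.2.isLocalization_basicOpen f
    have := M.isLocalizedModule_restrictBasicOpen f u.2
    exact IsFProjective.of_isLocalizedModule (S := Γ(X, X.basicOpen f)) (N := Γ(M, X.basicOpen f))
      (.powers f) (M.restrictBasicOpen f) hf
  · intro u s hs hf
    have (f : s) := u.2.isLocalization_basicOpen f.1
    have (f : s) := M.isLocalizedModule_restrictBasicOpen f.1 u.2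
    exact IsFProjective.of_isLocalized_span s hs (fun f : s => Γ(X, X.basicOpen f.1))
      (fun f : s => Γ(M, X.basicOpen f.1)) (fun f => M.restrictBasicOpen f.1) hf
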